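/- A \emph{trinity} is a triangulation (multiple edges allowed) of a closed oriented surface whose vertices are colored red, green and blue so that no edge joins vertices of the same color; edges carry the color missing at their ends. A triangle is black if its vertices are blue, green, red in clockwise order, and white otherwise. A \emph{planar trinity} is a trinity on the sphere with a chosen outer white triangle, whose vertices are called roots. A \emph{state} is a perfect matching between the non-outer white triangles and the non-root vertices in which matched pairs are incident. For a color $c$, let $G_c^*$ be the directed graph (embedded in the sphere) on the vertices of color $c$, with one arrow for each white triangle $w$: it starts at the vertex of color $c$ of the black triangle that shares the edge of color $c$ with $w$, crosses that edge, and ends at the vertex of color $c$ of $w$. In a state, the arrows of those $w$ that are matched to their vertex of color $c$ form a spanning arborescence of $G_c^*$ rooted at the root of color $c$, called the constituent of color $c$. The \emph{clocked arborescence} of $G_c^*$ is the output of the following greedy search. Start at the root of color $c$, in the outer white triangle, and turn counter-clockwise about the current vertex. When the tail end of an arrow is met whose head has not been reached yet, select the arrow, move along it to its head, and continue turning counter-clockwise there. After a full turn at a non-root vertex, go back along the selected arrow that leads to it and continue turning at its tail; stop after a full turn at the root. A \emph{clockwise move} on a state is possible if there are a red, a green and a blue edge that form a closed path through one vertex of each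 color and surround a disk not containing the three white triangles adjacent to these edges, so that the white triangles at the red, green and blue edge are matched to the green, blue and red vertex of the path, respectively. The move rematches these triangles to the blue, red and green vertex of the path, respectively, and leaves the rest of the state unchanged. (If the disk is a single black triangle, this is the move about a clockwise empty black triangle.) \textbf{Proposition.} Let $s$ be a state of a planar trinity. If for some color $c$ the constituent spanning arborescence of color $c$ of $s$ is not the clocked arborescence of $G_c^*$, then $s$ admits a clockwise move. -/

import Mathlib

/-- The three colours of vertices (and of edges) of a trinity. -/
inductive Color
  | red
  | green
  | blue

/-- The cyclic permutation red → green → blue → red. -/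
def Color.next : Color → Color
  | red => green
  | green => blue
  | blue => red

/-- The cyclic permutation red → blue → green → red. -/
def Color.prev : Color → Color
  | red => blue
  | green => red
  | blue => green

/-- A trinity (properly three-coloured triangulation of a closed oriented surface), as a
combinatorial map. `W` and `B` are the sets of white and black triangles. Every edge lies between
a white and a black triangle, and every triangle has one edge of each colour (the colour that does
not occur at the ends of the edge). So the surface is glued from the triangles according to three
bijections: `edge c w` is the black triangle on the other side of the colour `c` edge of `w`.
The edges of colour `c` are thereby indexed by the white triangles.

Orientation: the vertices (and likewise the edges) of a black triangle are blue, green, red in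
clockwise order, those of a white triangle are blue, green, red in counter-clockwise order. -/
structure Trinity (W B : Type*) where
  edge : Color → W ≃ B

namespace Trinity

variable {W B : Type*} (T : Trinity W B)

/-- Counter-clockwise rotation, among the white triangles, about their vertices of colour `c`:
from a white triangle one first crosses its edge of colour `c.prev` and gets to a black triangle,
then one crosses the edge of colour `c.next` of that black triangle. -/
def rot (c : Color) : Equiv.Perm W :=
  (T.edge c.prev).trans (T.edge c.next).symm

/-- The vertices of colour `c`: the cycles of the rotation `rot c`. -/
def ColorVertex (c : Color) : Type _ :=
  Quotient (Equiv.Perm.SameCycle.setoid (T.rot c))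

/-- All vertices. -/
def Vertex : Type _ := Σ c : Color, T.ColorVertex c

/-- The vertex of colour `c` of a white triangle. -/
def vertex (c : Color) (w : W) : T.Vertex :=
  ⟨c, Quotient.mk (Equiv.Perm.SameCycle.setoid (T.rot c)) w⟩

/-- The surface is connected: any two triangles are joined by a chain of adjacent triangles. -/
def Connected : Prop :=
  ∀ t t' : W ⊕ B,
    Relation.EqvGen (fun x y => ∃ c w, x = Sum.inl w ∧ y = Sum.inr (T.edge c w)) t t'

/-- The Euler characteristic: vertices minus edges plus triangles. -/
noncomputable def eulerChar : ℤ :=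
  (Nat.card T.Vertex : ℤ) - (Nat.card (Color × W) : ℤ) + (Nat.card (W ⊕ B) : ℤ)

/-! ### The directed ribbon graph `G_c^*`

Its vertices are the vertices of colour `c`. Its arrows are dual to the edges of colour `c` and so
they are indexed by the white triangles, too: the arrow `w` starts at the vertex of colour `c` of
the black triangle `edge c w`, crosses the common edge of colour `c`, and ends at the vertex of
colour `c` of `w`. As every triangle has exactly one vertex of colour `c`, the ends of arrows are
indexed by the triangles: `Sum.inl w` is the head end of the arrow `w`, and `Sum.inr b` is the tail
end of the arrow that starts in the black triangle `b`. -/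

/-- The arrow of `G_c^*` to which an end belongs. -/
def arrowOf (c : Color) : W ⊕ B → W
  | Sum.inl w => w
  | Sum.inr b => (T.edge c).symm b

/-- The opposite end of the same arrow of `G_c^*`. -/
def opp (c : Color) : W ⊕ B → W ⊕ B
  | Sum.inl w => Sum.inr (T.edge c w)
  | Sum.inr b => Sum.inl ((T.edge c).symm b)

/-- The next end of an arrow of `G_c^*` in the counter-clockwise direction about the same
vertex of colour `c`. -/
def ccw (c : Color) : W ⊕ B → W ⊕ B
  | Sum.inl w => Sum.inr (T.edge c.prev w)
  | Sum.inr b => Sum.inl ((T.edge c.next).symm b)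

end Trinity

/-- A planar trinity: a (finite) trinity on the sphere with a fixed outer white triangle. -/
structure PlanarTrinity (W B : Type*) extends Trinity W B where
  finite_white : Finite W
  connected : toTrinity.Connected
  sphere : toTrinity.eulerChar = 2
  outer : W

namespace PlanarTrinity

variable {W B : Type*} (T : PlanarTrinity W B)

/-- A state (Tutte matching): a perfect matching between the non-outer white triangles and the
non-root vertices, such that matched pairs are incident. -/
structure State where
  matching : {w : W // w ≠ T.outer} ≃ {x : T.Vertex // ∀ c, x ≠ T.vertex c T.outer}
  incident : ∀ w, ∃ c, (matching w).1 = T.vertex c w.1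

variable {T} in
/-- The constituent of colour `c` of a state, as a set of arrows of `G_c^*`: all `w` that are
matched to their vertex of colour `c`. -/
def State.arrows (s : T.State) (c : Color) : Set W :=
  {w | ∃ h : w ≠ T.outer, (s.matching ⟨w, h⟩).1 = T.vertex c w}

/-- The arrows that the greedy search selects in `G_c^*`, when it is at the end `d` and the arrows
in `S` have been selected so far: `w` gets selected if `d` is its tail end and its head is neither
the root nor the head of a previously selected arrow (so that no cycle is created). -/
def selected (c : Color) (d : W ⊕ B) (S : Set W) : Set W :=
  {w | d = Sum.inr (T.edge c w) ∧ T.vertex c w ≠ T.vertex c T.outer ∧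
    ∀ u ∈ S, T.vertex c w ≠ T.vertex c u}

open Classical in
/-- One step of the greedy search. If the arrow at the current end has just been selected, or was
selected before (in which case the search backtracks), then the search moves along it and turns on
counter-clockwise at its other end. Otherwise it just turns on counter-clockwise. -/
noncomputable def greedyStep (c : Color) (p : (W ⊕ B) × Set W) : (W ⊕ B) × Set W :=
  let S := p.2 ∪ T.selected c p.1 p.2
  (if T.arrowOf c p.1 ∈ S then T.ccw c (T.opp c p.1) else T.ccw c p.1, S)

/-- The clocked arborescence of `G_c^*`: all arrows that are selected by the greedy search, which
starts at the root of colour `c`, in the outer white triangle. -/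
def clocked (c : Color) : Set W :=
  {w | ∃ k : ℕ, w ∈ ((T.greedyStep c)^[k] (Sum.inl T.outer, ∅)).2}

/-- Three edges, namely for each colour `c` the edge of colour `c` of the white triangle `w c`,
form a closed path through a red, a green and a blue vertex: the ends of the edge of colour `c` are
the vertices of the other two colours of `w c`, and for each colour the two ends coincide. -/
def IsTriangle (w : Color → W) : Prop :=
  ∀ c : Color, T.vertex c (w c.next) = T.vertex c (w c.prev)

/-- The set `D` of triangles is a region that is bounded by the three edges above and that does not
contain the white triangles `w c`. If the three edges form a closed path, then this path is simple
(its vertices have different colours) and so on the sphere such a region is an embedded disk. -/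
def Surrounds (w : Color → W) (D : Set (W ⊕ B)) : Prop :=
  (∀ c, Sum.inr (T.edge c (w c)) ∈ D ∧ Sum.inl (w c) ∉ D) ∧
    ∀ c u, u ≠ w c → (Sum.inl u ∈ D ↔ Sum.inr (T.edge c u) ∈ D)

variable {T} in
/-- A clockwise move leads from the state `s` to the state `t`: there are three edges, one of each
colour, that surround a disk with their white triangles on the outside, those white triangles are
matched to the three vertices on the boundary of the disk, and this matching is switched from the
clockwise one (where the white triangle at the red, green, blue edge is matched to the green, blue,
red vertex) to the counter-clockwise one (to the blue, red, green vertex). -/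
def ClockwiseMove (s t : T.State) : Prop :=
  ∃ w : Color → W, T.IsTriangle w ∧ (∃ D, T.Surrounds w D) ∧
    (∀ c, w c ∈ s.arrows c.next ∧ w c ∈ t.arrows c.prev) ∧
    ∀ u, (∀ c, u.1 ≠ w c) → t.matching u = s.matching u

end PlanarTrinity

/-! ### Iterating an injective map on a finite type -/

section Orbit

variable {E : Type*} {g : E → E}

/-! Walk around the constituent of colour `c` from the outer triangle: turn counter-clockwise, and
move along an arrow exactly when it belongs to the constituent (`tour`). One side of the walk
follows the constituent, the other follows the edges of colour `c` that it does not cross. The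
matching orients both graphs by `Parent`. Being a descendant of a fixed vertex can change only at
the two ends of the arrow matched to that vertex, so the orbit contains both ends or neither. It is
also closed under turning, so by connectedness the walk passes every end (`exists_iterate_tour`).
This makes the constituent a spanning arborescence. Descendants of a vertex then occupy an interval
of time (`desc_leftVertex_iff_time`, `desc_rightVertex_iff_time`); these intervals do the work of
planarity, and the order in which the two ends of an arrow are passed constrains the colour it is
matched to.

If the walk is not the greedy search, some arrow `e` outside the constituent has its tail passed
before the tail of the constituent arrow `f` with the same head (`arrows_eq_clocked`). The order of
passage is tail of `e`, tail of `f`, head of `e`, head of `f`, so `e` is matched to colour `c.prev`.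
The ends passed between the tail of `f` and the head of `e` form a region. Take it shortest
possible: then `e` is the only arrow leading into it, as another would deviate with a shorter region
(`exists_shorter`). The region has as many heads as tails, so exactly one arrow `a` leads out, and
its place in the time order forces it to be matched to colour `c.next`. The edges belonging to `a`,
`e`, `f` close up to a triangle around the region, which gives the move. -/

theorem exists_pos_iterate_eq_self [Finite E] (hg : Function.Injective g) (p : E) :
    ∃ n, 0 < n ∧ g^[n] p = p := by
  have := hg.mem_periodicPts p
  obtain ⟨n, hn, h⟩ := this
  exact ⟨n, hn, h⟩

/-- If along the iteration of `g` a property is gained only at `p` and lost only at `q`, then the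
orbit of `p` passes through `q`. -/
theorem exists_iterate_eq_of_crossing [Finite E] (hg : Function.Injective g) {M : E → Prop} {p q : E}
    (hstep : ∀ d, d ≠ p → d ≠ q → (M (g d) ↔ M d)) (hp : ¬ M p) (hp' : M (g p)) :
    ∃ n, g^[n] p = q := by
  by_contra! hne
  obtain ⟨N, hN, hper⟩ := exists_pos_iterate_eq_self hg p
  have key : ∀ n, M (g^[n + 1] p) := by
    intro n
    induction n with
    | zero => simpa using hp'
    | succ n ih =>
      rw [Function.iterate_succ_apply']
      by_cases h : g^[n + 1] p = p
      · rwa [h]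
      · exact (hstep _ h (hne _)).2 ih
  have := key (N - 1)
  rw [Nat.sub_add_cancel hN, hper] at this
  exact hp this

theorem exists_iterate_eq_symm [Finite E] (hg : Function.Injective g) {p q : E} {n : ℕ}
    (h : g^[n] p = q) : ∃ m, g^[m] q = p := by
  obtain ⟨N, hN, hper⟩ := exists_pos_iterate_eq_self hg p
  refine ⟨N * n - n, ?_⟩
  rw [← h, ← Function.iterate_add_apply, Nat.sub_add_cancel (Nat.le_mul_of_pos_left n hN),
    Function.iterate_mul]
  exact Function.iterate_fixed hper n

variable {x₀ : E} (hx : ∀ d, ∃ k, g^[k] x₀ = d)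

open Classical in
/-- The first time at which the iteration of `g` from `x₀` arrives at `d`. -/
noncomputable def visitTime (hx : ∀ d, ∃ k, g^[k] x₀ = d) (d : E) : ℕ := Nat.find (hx d)

theorem iterate_visitTime (d : E) : g^[visitTime hx d] x₀ = d := by
  classical
  exact Nat.find_spec (hx d)

theorem visitTime_le {d : E} {k : ℕ} (h : g^[k] x₀ = d) : visitTime hx d ≤ k := by
  classical
  exact Nat.find_min' (hx d) h

theorem visitTime_start : visitTime hx x₀ = 0 :=
  Nat.le_zero.1 (visitTime_le hx rfl)

theorem visitTime_injective : Function.Injective (visitTime hx) := fun d d' h => by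
  rw [← iterate_visitTime hx d, h, iterate_visitTime]

theorem visitTime_iterate {d : E} {j : ℕ} (hj : j ≤ visitTime hx d) :
    visitTime hx (g^[j] x₀) = j := by
  refine le_antisymm (visitTime_le hx rfl) ?_
  by_contra! hlt
  set i := visitTime hx (g^[j] x₀) with hi
  have h1 : g^[i] x₀ = g^[j] x₀ := iterate_visitTime hx _
  have h2 : g^[(visitTime hx d - j) + i] x₀ = d := by
    rw [Function.iterate_add_apply, h1, ← Function.iterate_add_apply, Nat.sub_add_cancel hj,
      iterate_visitTime]
  have := visitTime_le hx h2
  omega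

/-- A later visit to `j` guarantees that the orbit has not yet closed up when it leaves `d`. -/
theorem visitTime_apply {d : E} {j : E} (h : visitTime hx d < visitTime hx j) :
    visitTime hx (g d) = visitTime hx d + 1 := by
  have := visitTime_iterate hx (Nat.succ_le_of_lt h)
  rwa [Nat.succ_eq_add_one, Function.iterate_succ_apply', iterate_visitTime] at this

theorem visitTime_apply_of_ne (hg : Function.Injective g) {d : E} (h : g d ≠ x₀) :
    visitTime hx (g d) = visitTime hx d + 1 := by
  have h1 : visitTime hx (g d) ≤ visitTime hx d + 1 :=
    visitTime_le hx (by rw [Function.iterate_succ_apply', iterate_visitTime])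
  have h2 := iterate_visitTime hx (g d)
  rcases hk : visitTime hx (g d) with _ | k
  · rw [hk] at h2
    exact absurd h2.symm h
  · rw [hk, Function.iterate_succ_apply'] at h2
    have := visitTime_le hx (hg h2)
    omega

/-- The property fails at the start, so before it can hold at `q` it must have been gained at `p`.
-/
theorem visitTime_crossing_lt {M : E → Prop} {p q : E}
    (hstep : ∀ d, d ≠ p → d ≠ q → (M (g d) ↔ M d)) (h0 : ¬ M x₀) (hq : M q) :
    visitTime hx p < visitTime hx q := by
  by_contra! hle
  have key : ∀ j, j ≤ visitTime hx q → ¬ M (g^[j] x₀) := by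
    intro j
    induction j with
    | zero => exact fun _ => h0
    | succ j ih =>
      intro hj
      rw [Function.iterate_succ_apply']
      have hj' : visitTime hx (g^[j] x₀) = j := visitTime_iterate hx (by omega : j ≤ visitTime hx q)
      rw [hstep]
      · exact ih (by omega)
      · intro h; rw [h] at hj'; omega
      · intro h; rw [h] at hj'; omega
  exact key _ le_rfl (by rwa [iterate_visitTime])

/-- A property that is gained only at `p` and lost only at `q` holds exactly in between. -/
theorem crossing_iff_visitTime {M : E → Prop} {p q : E}
    (hstep : ∀ d, d ≠ p → d ≠ q → (M (g d) ↔ M d)) (h0 : ¬ M x₀) (hp : M (g p))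
    (hq : M q) (hq' : ¬ M (g q)) (d : E) :
    M d ↔ visitTime hx p < visitTime hx d ∧ visitTime hx d ≤ visitTime hx q := by
  have hlt := visitTime_crossing_lt hx hstep h0 hq
  have key : ∀ j, j ≤ visitTime hx d →
      (M (g^[j] x₀) ↔ visitTime hx p < j ∧ j ≤ visitTime hx q) := by
    intro j
    induction j with
    | zero => intro _; simpa using h0
    | succ j ih =>
      intro hj
      have hj' : visitTime hx (g^[j] x₀) = j := visitTime_iterate hx (by omega : j ≤ visitTime hx d)
      have ih := ih (by omega)
      rw [Function.iterate_succ_apply']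
      by_cases h1 : g^[j] x₀ = p
      · rw [h1] at hj' ⊢
        simp only [hp, true_iff]; omega
      by_cases h2 : g^[j] x₀ = q
      · rw [h2] at hj' ⊢
        simp only [hq', false_iff]; omega
      rw [hstep _ h1 h2, ih]
      have n1 : j ≠ visitTime hx p := fun h => h1 (by rw [h, iterate_visitTime])
      have n2 : j ≠ visitTime hx q := fun h => h2 (by rw [h, iterate_visitTime])
      omega
  have := key _ le_rfl
  rwa [iterate_visitTime] at this

end Orbit

/-! ### Colours -/

namespace Color

@[simp] theorem next_next (c : Color) : c.next.next = c.prev := by cases c <;> rfl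
@[simp] theorem prev_prev (c : Color) : c.prev.prev = c.next := by cases c <;> rfl
@[simp] theorem next_prev (c : Color) : c.next.prev = c := by cases c <;> rfl
@[simp] theorem prev_next (c : Color) : c.prev.next = c := by cases c <;> rfl
theorem next_ne (c : Color) : c.next ≠ c := by cases c <;> simp [next]
theorem prev_ne (c : Color) : c.prev ≠ c := by cases c <;> simp [prev]
theorem next_ne_prev (c : Color) : c.next ≠ c.prev := by cases c <;> simp [next, prev]

theorem eq_or (c c' : Color) : c' = c ∨ c' = c.next ∨ c' = c.prev := by
  cases c <;> cases c' <;> simp [next, prev]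

theorem forall_iff (c : Color) {p : Color → Prop} :
    (∀ c', p c') ↔ p c ∧ p c.next ∧ p c.prev := by
  refine ⟨fun h => ⟨h _, h _, h _⟩, fun ⟨h1, h2, h3⟩ c' => ?_⟩
  rcases eq_or c c' with rfl | rfl | rfl <;> assumption

theorem exists_fun {α : Type*} (c : Color) (x y z : α) :
    ∃ f : Color → α, f c = x ∧ f c.next = y ∧ f c.prev = z := by
  cases c
  · exact ⟨fun | red => x | green => y | blue => z, rfl, rfl, rfl⟩
  · exact ⟨fun | green => x | blue => y | red => z, rfl, rfl, rfl⟩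
  · exact ⟨fun | blue => x | red => y | green => z, rfl, rfl, rfl⟩

end Color

/-! ### Ends of arrows and the vertices next to them -/

namespace Trinity

variable {W B : Type*} (T : Trinity W B)

theorem vertex_color {c c' : Color} {w w' : W} (h : T.vertex c w = T.vertex c' w') : c = c' :=
  congrArg Sigma.fst h

theorem vertex_eq_iff {c : Color} {w w' : W} :
    T.vertex c w = T.vertex c w' ↔ (T.rot c).SameCycle w w' := by
  constructor
  · intro h
    have h' := eq_of_heq (Sigma.mk.inj h).2
    exact Quotient.exact h'
  · intro h
    exact congrArg (Sigma.mk c) (Quotient.sound h)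

theorem vertex_rot (c : Color) (w : W) : T.vertex c (T.rot c w) = T.vertex c w :=
  T.vertex_eq_iff.2 (Equiv.Perm.sameCycle_apply_left.2 (Equiv.Perm.SameCycle.refl _ _))

theorem rot_apply (c : Color) (w : W) :
    T.rot c w = (T.edge c.next).symm (T.edge c.prev w) := rfl

/-- The vertex of colour `c` at an end of an arrow of `G_c^*`. -/
def leftVertex (c : Color) : W ⊕ B → T.Vertex
  | Sum.inl w => T.vertex c w
  | Sum.inr b => T.vertex c ((T.edge c.prev).symm b)

/-- The vertex of another colour that lies between an end of an arrow of `G_c^*` and the preceding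
end in the counter-clockwise order. -/
def rightVertex (c : Color) : W ⊕ B → T.Vertex
  | Sum.inl w => T.vertex c.prev w
  | Sum.inr b => T.vertex c.next ((T.edge c).symm b)

@[simp] theorem opp_opp (c : Color) (d : W ⊕ B) : T.opp c (T.opp c d) = d := by
  cases d <;> simp [opp]

@[simp] theorem arrowOf_opp (c : Color) (d : W ⊕ B) : T.arrowOf c (T.opp c d) = T.arrowOf c d := by
  cases d <;> simp [opp, arrowOf]

theorem eq_or_eq_opp (c : Color) (d : W ⊕ B) :
    d = Sum.inl (T.arrowOf c d) ∨ d = Sum.inr (T.edge c (T.arrowOf c d)) := by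
  cases d <;> simp [arrowOf]

theorem ccw_injective (c : Color) : Function.Injective (T.ccw c) := by
  rintro (a | a) (b | b) h <;> simp_all [ccw]

theorem leftVertex_ccw (c : Color) (d : W ⊕ B) :
    T.leftVertex c (T.ccw c d) = T.leftVertex c d := by
  rcases d with w | b
  · simp [ccw, leftVertex]
  · have := T.vertex_rot c ((T.edge c.prev).symm b)
    simpa [ccw, leftVertex, rot_apply] using this

/-- The edge crossed by an arrow joins the right vertices of its two ends. Turning past the arrow
thus means moving along that edge. -/
theorem rightVertex_ccw (c : Color) (d : W ⊕ B) :
    T.rightVertex c (T.ccw c d) = T.rightVertex c (T.opp c d) := by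
  rcases d with w | b
  · have := T.vertex_rot c.next ((T.edge c).symm (T.edge c.prev w))
    simp only [rot_apply, Color.next_next, Color.next_prev, Equiv.apply_symm_apply,
      Equiv.symm_apply_apply] at this
    simp [ccw, opp, rightVertex, this]
  · have := T.vertex_rot c.prev ((T.edge c.next).symm b)
    simp only [rot_apply, Color.prev_prev, Color.prev_next, Equiv.apply_symm_apply] at this
    simp [ccw, opp, rightVertex, this]

/-- About a vertex, a set of black triangles is left as often as it is entered. -/
theorem exists_vertex_eq_of_crossing [Finite W] {c : Color} {D : Set B} {w : W}
    (h1 : T.edge c.prev w ∈ D) (h2 : T.edge c.next w ∉ D) :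
    ∃ u, T.vertex c u = T.vertex c w ∧ T.edge c.next u ∈ D ∧ T.edge c.prev u ∉ D := by
  by_contra! h
  have key : ∀ n, T.vertex c ((T.rot c)^[n] w) = T.vertex c w ∧
      T.edge c.prev ((T.rot c)^[n] w) ∈ D := by
    intro n
    induction n with
    | zero => exact ⟨rfl, h1⟩
    | succ n ih =>
      rw [Function.iterate_succ_apply']
      have h3 := (T.vertex_rot c ((T.rot c)^[n] w)).trans ih.1
      exact ⟨h3, h _ h3 (by rw [rot_apply, Equiv.apply_symm_apply]; exact ih.2)⟩
  obtain ⟨N, hN, hper⟩ := exists_pos_iterate_eq_self (T.rot c).injective w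
  obtain ⟨n, rfl⟩ := Nat.exists_eq_succ_of_ne_zero hN.ne'
  rw [Function.iterate_succ_apply', rot_apply, Equiv.symm_apply_eq] at hper
  exact h2 (hper ▸ (key n).2)

end Trinity

namespace PlanarTrinity

variable {W B : Type*} {T : PlanarTrinity W B}

/-! ### States in terms of their constituents -/

namespace State

variable (s : T.State)

theorem ne_outer {c : Color} {w : W} (h : w ∈ s.arrows c) : w ≠ T.outer := h.1

theorem outer_notMem (c : Color) : T.outer ∉ s.arrows c := fun h => h.1 rfl

theorem vertex_ne_root {c : Color} {w : W} (h : w ∈ s.arrows c) (c' : Color) :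
    T.vertex c w ≠ T.vertex c' T.outer := by
  obtain ⟨h1, h2⟩ := h
  rw [← h2]
  exact (s.matching ⟨w, h1⟩).2 c'

theorem exists_mem_arrows {w : W} (h : w ≠ T.outer) : ∃ c, w ∈ s.arrows c := by
  obtain ⟨c, hc⟩ := s.incident ⟨w, h⟩
  exact ⟨c, h, hc⟩

theorem color_unique {c c' : Color} {w : W} (h : w ∈ s.arrows c) (h' : w ∈ s.arrows c') :
    c = c' := by
  obtain ⟨_, h2⟩ := h
  obtain ⟨_, h2'⟩ := h'
  exact T.vertex_color (h2.symm.trans h2')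

theorem arrow_unique {c c' : Color} {w w' : W} (h : w ∈ s.arrows c) (h' : w' ∈ s.arrows c')
    (hv : T.vertex c w = T.vertex c' w') : w = w' := by
  obtain ⟨h1, h2⟩ := h
  obtain ⟨h1', h2'⟩ := h'
  have := s.matching.injective (Subtype.ext (h2.trans (hv.trans h2'.symm)))
  exact congrArg Subtype.val this

theorem exists_arrow {c : Color} {w : W} (h : T.vertex c w ≠ T.vertex c T.outer) :
    ∃ u ∈ s.arrows c, T.vertex c u = T.vertex c w := by
  have hr : ∀ c', T.vertex c w ≠ T.vertex c' T.outer := by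
    intro c' h'
    obtain rfl := T.vertex_color h'
    exact h h'
  obtain ⟨⟨u, hu⟩, hm⟩ := s.matching.surjective ⟨T.vertex c w, hr⟩
  obtain ⟨c', hcol⟩ := s.incident ⟨u, hu⟩
  rw [hm] at hcol
  obtain rfl := T.vertex_color hcol
  exact ⟨u, ⟨hu, by rw [hm]; exact hcol⟩, Eq.symm hcol⟩

/-! ### The tour around a constituent -/

open Classical in
/-- One step of the tour around the constituent of colour `c`. -/
noncomputable def tour (c : Color) (d : W ⊕ B) : W ⊕ B :=
  if T.arrowOf c d ∈ s.arrows c then T.ccw c (T.opp c d) else T.ccw c d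

variable {s}

theorem tour_of_mem {c : Color} {d : W ⊕ B} (h : T.arrowOf c d ∈ s.arrows c) :
    s.tour c d = T.ccw c (T.opp c d) := if_pos h

theorem tour_of_notMem {c : Color} {d : W ⊕ B} (h : T.arrowOf c d ∉ s.arrows c) :
    s.tour c d = T.ccw c d := if_neg h

variable (s) in
theorem tour_injective (c : Color) : Function.Injective (s.tour c) := by
  intro d d' h
  by_cases h1 : T.arrowOf c d ∈ s.arrows c <;> by_cases h2 : T.arrowOf c d' ∈ s.arrows c
  · rw [tour_of_mem h1, tour_of_mem h2] at h
    have := congrArg (T.opp c) (T.ccw_injective c h)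
    simpa using this
  · rw [tour_of_mem h1, tour_of_notMem h2] at h
    have := T.ccw_injective c h
    rw [← this] at h2
    simp [h1] at h2
  · rw [tour_of_notMem h1, tour_of_mem h2] at h
    have := T.ccw_injective c h
    rw [this] at h1
    simp [h2] at h1
  · rw [tour_of_notMem h1, tour_of_notMem h2] at h
    exact T.ccw_injective c h

/-- Here and in the next three lemmas: at a constituent arrow the left vertex moves along the arrow
and the right vertex stays; at any other arrow the left vertex stays and the right vertex moves
along the dual edge. -/
theorem leftVertex_tour_of_mem {c : Color} {d : W ⊕ B} (h : T.arrowOf c d ∈ s.arrows c) :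
    T.leftVertex c (s.tour c d) = T.leftVertex c (T.opp c d) := by
  rw [tour_of_mem h, T.leftVertex_ccw]

theorem leftVertex_tour_of_notMem {c : Color} {d : W ⊕ B} (h : T.arrowOf c d ∉ s.arrows c) :
    T.leftVertex c (s.tour c d) = T.leftVertex c d := by
  rw [tour_of_notMem h, T.leftVertex_ccw]

theorem rightVertex_tour_of_mem {c : Color} {d : W ⊕ B} (h : T.arrowOf c d ∈ s.arrows c) :
    T.rightVertex c (s.tour c d) = T.rightVertex c d := by
  rw [tour_of_mem h, T.rightVertex_ccw, T.opp_opp]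

theorem rightVertex_tour_of_notMem {c : Color} {d : W ⊕ B} (h : T.arrowOf c d ∉ s.arrows c) :
    T.rightVertex c (s.tour c d) = T.rightVertex c (T.opp c d) := by
  rw [tour_of_notMem h, T.rightVertex_ccw]

/-! ### Parents in the constituent and in its dual tree -/

variable (s) in
/-- `s.Parent c x z`: in the constituent of colour `c` (if `x` has colour `c`), or in the tree that
is formed by the edges of colour `c` not crossed by the constituent (otherwise), the edge that
belongs to the white triangle matched to `x` joins `x` to `z`. -/
def Parent (c : Color) (x z : T.Vertex) : Prop :=
  (∃ a ∈ s.arrows c, x = T.vertex c a ∧ z = T.leftVertex c (Sum.inr (T.edge c a))) ∨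
  (∃ a ∈ s.arrows c.prev, x = T.vertex c.prev a ∧ z = T.vertex c.next a) ∨
  (∃ a ∈ s.arrows c.next, x = T.vertex c.next a ∧ z = T.vertex c.prev a)

theorem Parent.unique {c : Color} {x z z' : T.Vertex} (h : s.Parent c x z)
    (h' : s.Parent c x z') : z = z' := by
  rcases h with ⟨a, ha, rfl, rfl⟩ | ⟨a, ha, rfl, rfl⟩ | ⟨a, ha, rfl, rfl⟩ <;>
  rcases h' with ⟨b, hb, h1, rfl⟩ | ⟨b, hb, h1, rfl⟩ | ⟨b, hb, h1, rfl⟩ <;>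
  first
  | exact absurd (T.vertex_color h1) (Color.prev_ne c)
  | exact absurd (T.vertex_color h1) (Color.prev_ne c).symm
  | exact absurd (T.vertex_color h1) (Color.next_ne c)
  | exact absurd (T.vertex_color h1) (Color.next_ne c).symm
  | exact absurd (T.vertex_color h1) (Color.next_ne_prev c)
  | exact absurd (T.vertex_color h1) (Color.next_ne_prev c).symm
  | rw [s.arrow_unique ha hb h1]

theorem not_parent_root {c c' : Color} {z : T.Vertex} :
    ¬ s.Parent c (T.vertex c' T.outer) z := by
  rintro (⟨a, ha, h, -⟩ | ⟨a, ha, h, -⟩ | ⟨a, ha, h, -⟩) <;> exact s.vertex_ne_root ha _ h.symm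

variable (s) in
/-- `x` is a descendant of `y` with respect to `Parent`. -/
def Desc (c : Color) (y x : T.Vertex) : Prop := Relation.ReflTransGen (s.Parent c) x y

theorem desc_self (c : Color) (y : T.Vertex) : s.Desc c y y := Relation.ReflTransGen.refl

theorem Parent.desc_iff {c : Color} {x z y : T.Vertex} (h : s.Parent c x z) (hne : x ≠ y) :
    s.Desc c y x ↔ s.Desc c y z := by
  constructor
  · intro hx
    rcases Relation.ReflTransGen.cases_head hx with hxy | ⟨z', hz', hd⟩
    · exact absurd hxy hne
    · rwa [h.unique hz']
  · exact fun hz => Relation.ReflTransGen.head h hz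

theorem desc_root {c c' : Color} {y : T.Vertex} (h : s.Desc c y (T.vertex c' T.outer)) :
    y = T.vertex c' T.outer := by
  rcases Relation.ReflTransGen.cases_head h with hxy | ⟨z', hz', -⟩
  · exact hxy.symm
  · exact absurd hz' not_parent_root

variable (s) in
/-- The iterated parents of `x` end at a root. -/
def Rooted (c : Color) (x : T.Vertex) : Prop := Acc (fun z x => s.Parent c x z) x

theorem rooted_root (c c' : Color) : s.Rooted c (T.vertex c' T.outer) :=
  Acc.intro _ fun _ h => absurd h not_parent_root

theorem Parent.rooted_iff {c : Color} {x z : T.Vertex} (h : s.Parent c x z) :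
    s.Rooted c x ↔ s.Rooted c z := by
  constructor
  · exact fun hx => hx.inv h
  · intro hz
    refine Acc.intro _ fun z' h' => ?_
    rwa [h'.unique h]

/-- Otherwise `x` would lie on a cycle of parents. The induction pushes the cycle on to the parent
of `x`. -/
theorem Parent.not_desc {c : Color} {x z : T.Vertex} (h : s.Parent c x z)
    (hx : s.Rooted c x) : ¬ s.Desc c x z := by
  induction hx generalizing z with
  | intro x _ ih =>
    intro hd
    rcases Relation.ReflTransGen.cases_head hd with rfl | ⟨z', hz', hd'⟩
    · exact ih _ h h Relation.ReflTransGen.refl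
    · exact ih _ h hz' (hd'.tail h)

theorem parent_of_mem {c : Color} {a : W} (h : a ∈ s.arrows c) :
    s.Parent c (T.leftVertex c (Sum.inl a)) (T.leftVertex c (Sum.inr (T.edge c a))) :=
  Or.inl ⟨a, h, rfl, rfl⟩

theorem parent_of_mem_prev {c : Color} {a : W} (h : a ∈ s.arrows c.prev) :
    s.Parent c (T.rightVertex c (Sum.inl a)) (T.rightVertex c (Sum.inr (T.edge c a))) :=
  Or.inr (Or.inl ⟨a, h, rfl, by simp [Trinity.rightVertex]⟩)

theorem parent_of_mem_next {c : Color} {a : W} (h : a ∈ s.arrows c.next) :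
    s.Parent c (T.rightVertex c (Sum.inr (T.edge c a))) (T.rightVertex c (Sum.inl a)) :=
  Or.inr (Or.inr ⟨a, h, by simp [Trinity.rightVertex], rfl⟩)

theorem rightVertex_inr (c : Color) (a : W) :
    T.rightVertex c (Sum.inr (T.edge c a)) = T.vertex c.next a := by simp [Trinity.rightVertex]

theorem cases_color (c : Color) (a : W) :
    a = T.outer ∨ a ∈ s.arrows c ∨ a ∈ s.arrows c.prev ∨ a ∈ s.arrows c.next := by
  by_cases h : a = T.outer
  · exact Or.inl h
  · obtain ⟨c', hc'⟩ := s.exists_mem_arrows h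
    rcases Color.eq_or c c' with rfl | rfl | rfl <;> simp [hc']

theorem notMem_of_mem {c c' : Color} {a : W} (h : a ∈ s.arrows c) (hne : c ≠ c') :
    a ∉ s.arrows c' := fun hmem => hne (s.color_unique h hmem)

/-- Both ends of an arrow in the constituent have left vertices with the same ancestors, except for
the vertex to which the arrow is matched. -/
theorem desc_leftVertex_iff {c : Color} {a : W} (h : a ∈ s.arrows c) {y : T.Vertex}
    (hy : T.vertex c a ≠ y) :
    s.Desc c y (T.leftVertex c (Sum.inl a)) ↔
      s.Desc c y (T.leftVertex c (Sum.inr (T.edge c a))) :=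
  (parent_of_mem h).desc_iff hy

/-- Both ends of an arrow outside the constituent have right vertices with the same ancestors,
except for the vertex to which the arrow is matched. -/
theorem desc_rightVertex_iff {c : Color} {a : W} (h : a ∉ s.arrows c) {y : T.Vertex}
    (ho : a = T.outer → ∀ c', y ≠ T.vertex c' T.outer)
    (hy : ∀ c', a ∈ s.arrows c' → T.vertex c' a ≠ y) :
    s.Desc c y (T.rightVertex c (Sum.inl a)) ↔
      s.Desc c y (T.rightVertex c (Sum.inr (T.edge c a))) := by
  rcases cases_color (s := s) c a with ha | ha | ha | ha
  · rw [rightVertex_inr]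
    subst ha
    exact iff_of_false (fun hd => ho rfl _ (desc_root hd)) (fun hd => ho rfl _ (desc_root hd))
  · exact absurd ha h
  · exact (parent_of_mem_prev ha).desc_iff (hy _ ha)
  · refine ((parent_of_mem_next ha).desc_iff ?_).symm
    rw [rightVertex_inr]
    exact hy _ ha

theorem desc_leftVertex_tour_iff {c : Color} {d : W ⊕ B} {y : T.Vertex}
    (h : T.arrowOf c d ∈ s.arrows c → T.vertex c (T.arrowOf c d) ≠ y) :
    s.Desc c y (T.leftVertex c (s.tour c d)) ↔ s.Desc c y (T.leftVertex c d) := by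
  by_cases hA : T.arrowOf c d ∈ s.arrows c
  · rw [leftVertex_tour_of_mem hA]
    have := desc_leftVertex_iff hA (h hA)
    rcases d with a | b
    · exact this.symm
    · simpa [Trinity.opp, Trinity.arrowOf] using this
  · rw [leftVertex_tour_of_notMem hA]

theorem desc_rightVertex_tour_iff {c : Color} {d : W ⊕ B} {y : T.Vertex}
    (ho : T.arrowOf c d = T.outer → ∀ c', y ≠ T.vertex c' T.outer)
    (h : ∀ c', T.arrowOf c d ∈ s.arrows c' → T.vertex c' (T.arrowOf c d) ≠ y) :
    s.Desc c y (T.rightVertex c (s.tour c d)) ↔ s.Desc c y (T.rightVertex c d) := by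
  by_cases hA : T.arrowOf c d ∈ s.arrows c
  · rw [rightVertex_tour_of_mem hA]
  · rw [rightVertex_tour_of_notMem hA]
    have := desc_rightVertex_iff hA ho h
    rcases d with a | b
    · exact this.symm
    · simpa [Trinity.opp, Trinity.arrowOf] using this

/-- Rootedness passes both ways along a parent edge. The only other edge that the tour follows is
that of the outer triangle, which joins two roots. -/
theorem rooted_tour {c : Color} {d : W ⊕ B} (hl : s.Rooted c (T.leftVertex c d))
    (hr : s.Rooted c (T.rightVertex c d)) :
    s.Rooted c (T.leftVertex c (s.tour c d)) ∧ s.Rooted c (T.rightVertex c (s.tour c d)) := by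
  by_cases hA : T.arrowOf c d ∈ s.arrows c
  · rw [leftVertex_tour_of_mem hA, rightVertex_tour_of_mem hA]
    refine ⟨?_, hr⟩
    have hp := (parent_of_mem hA).rooted_iff
    rcases d with a | b
    · exact hp.1 hl
    · simp only [Trinity.arrowOf, Equiv.apply_symm_apply] at hp
      exact hp.2 hl
  · rw [leftVertex_tour_of_notMem hA, rightVertex_tour_of_notMem hA]
    refine ⟨hl, ?_⟩
    have hp : s.Rooted c (T.rightVertex c (Sum.inl (T.arrowOf c d))) ↔
        s.Rooted c (T.rightVertex c (Sum.inr (T.edge c (T.arrowOf c d)))) := by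
      rcases cases_color (s := s) c (T.arrowOf c d) with ha | ha | ha | ha
      · rw [rightVertex_inr, ha]
        exact iff_of_true (rooted_root _ _) (rooted_root _ _)
      · exact absurd ha hA
      · exact (parent_of_mem_prev ha).rooted_iff
      · exact (parent_of_mem_next ha).rooted_iff.symm
    rcases d with a | b
    · exact hp.1 hr
    · simp only [Trinity.arrowOf, Equiv.apply_symm_apply] at hp
      exact hp.2 hr

variable (s) in
theorem rooted_iterate_tour (c : Color) (k : ℕ) :
    s.Rooted c (T.leftVertex c ((s.tour c)^[k] (Sum.inl T.outer))) ∧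
      s.Rooted c (T.rightVertex c ((s.tour c)^[k] (Sum.inl T.outer))) := by
  induction k with
  | zero => exact ⟨rooted_root _ _, rooted_root _ _⟩
  | succ k ih =>
    rw [Function.iterate_succ_apply']
    exact rooted_tour ih.1 ih.2

theorem finite_ends (T : PlanarTrinity W B) : Finite (W ⊕ B) := by
  have := T.finite_white
  have := Finite.of_equiv W (T.edge Color.red)
  infer_instance

theorem arrowOf_eq_iff {c : Color} {d : W ⊕ B} {a : W} :
    T.arrowOf c d = a ↔ d = Sum.inl a ∨ d = Sum.inr (T.edge c a) := by
  rcases d with w | b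
  · simp [Trinity.arrowOf]
  · simp [Trinity.arrowOf, Equiv.symm_apply_eq]

theorem arrowOf_ne {c : Color} {d : W ⊕ B} {a : W} (h1 : d ≠ Sum.inl a)
    (h2 : d ≠ Sum.inr (T.edge c a)) : T.arrowOf c d ≠ a := by
  rw [Ne, arrowOf_eq_iff]
  tauto

/-! The ancestors of the left and right vertices change only where the tour passes the arrow
matched to the ancestor in question. -/

theorem desc_leftVertex_step {c : Color} {a : W} (ha : a ∈ s.arrows c) (d : W ⊕ B)
    (h1 : d ≠ Sum.inl a) (h2 : d ≠ Sum.inr (T.edge c a)) :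
    s.Desc c (T.vertex c a) (T.leftVertex c (s.tour c d)) ↔
      s.Desc c (T.vertex c a) (T.leftVertex c d) :=
  desc_leftVertex_tour_iff fun h hv => arrowOf_ne h1 h2 (s.arrow_unique h ha hv)

theorem desc_rightVertex_step {c c' : Color} {a : W} (ha : a ∈ s.arrows c') (d : W ⊕ B)
    (h1 : d ≠ Sum.inl a) (h2 : d ≠ Sum.inr (T.edge c a)) :
    s.Desc c (T.vertex c' a) (T.rightVertex c (s.tour c d)) ↔
      s.Desc c (T.vertex c' a) (T.rightVertex c d) :=
  desc_rightVertex_tour_iff (fun _ c'' => s.vertex_ne_root ha c'')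
    fun _ h hv => arrowOf_ne h1 h2 (s.arrow_unique h ha hv)

/-- The edge of colour `c` of the outer triangle joins two roots without making either a parent of
the other. It separates their descendants, and so takes the role of the arrow matched to a vertex.
-/
theorem desc_rightVertex_outer_step {c : Color} (d : W ⊕ B)
    (h1 : d ≠ Sum.inl T.outer) (h2 : d ≠ Sum.inr (T.edge c T.outer)) :
    s.Desc c (T.vertex c.next T.outer) (T.rightVertex c (s.tour c d)) ↔
      s.Desc c (T.vertex c.next T.outer) (T.rightVertex c d) :=
  desc_rightVertex_tour_iff (fun h => absurd h (arrowOf_ne h1 h2))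
    fun _ h hv => s.vertex_ne_root h _ hv

theorem leftVertex_tour_tail {c : Color} {a : W} (ha : a ∈ s.arrows c) :
    T.leftVertex c (s.tour c (Sum.inr (T.edge c a))) = T.vertex c a := by
  rw [leftVertex_tour_of_mem (by simpa [Trinity.arrowOf] using ha)]
  simp [Trinity.opp, Trinity.leftVertex]

theorem leftVertex_tour_head {c : Color} {a : W} (ha : a ∈ s.arrows c) :
    T.leftVertex c (s.tour c (Sum.inl a)) = T.leftVertex c (Sum.inr (T.edge c a)) := by
  rw [leftVertex_tour_of_mem (by simpa [Trinity.arrowOf] using ha)]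
  simp [Trinity.opp]

theorem rightVertex_tour_tail {c : Color} {a : W} (ha : a ∉ s.arrows c) :
    T.rightVertex c (s.tour c (Sum.inr (T.edge c a))) = T.vertex c.prev a := by
  rw [rightVertex_tour_of_notMem (by simpa [Trinity.arrowOf] using ha)]
  simp [Trinity.opp, Trinity.rightVertex]

theorem rightVertex_tour_head {c : Color} {a : W} (ha : a ∉ s.arrows c) :
    T.rightVertex c (s.tour c (Sum.inl a)) = T.vertex c.next a := by
  rw [rightVertex_tour_of_notMem (by simpa [Trinity.arrowOf] using ha)]
  simp [Trinity.opp, Trinity.rightVertex]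

theorem not_desc_leftVertex_tail {c : Color} {a : W} (ha : a ∈ s.arrows c)
    (hr : s.Rooted c (T.vertex c a)) :
    ¬ s.Desc c (T.vertex c a) (T.leftVertex c (Sum.inr (T.edge c a))) :=
  (parent_of_mem ha).not_desc hr

theorem not_desc_vertex_next {c : Color} {a : W} (ha : a ∈ s.arrows c.prev)
    (hr : s.Rooted c (T.vertex c.prev a)) :
    ¬ s.Desc c (T.vertex c.prev a) (T.vertex c.next a) := by
  have := (parent_of_mem_prev ha).not_desc hr
  rwa [rightVertex_inr] at this

theorem not_desc_vertex_prev {c : Color} {a : W} (ha : a ∈ s.arrows c.next)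
    (hr : s.Rooted c (T.vertex c.next a)) :
    ¬ s.Desc c (T.vertex c.next a) (T.vertex c.prev a) := by
  have := (parent_of_mem_next ha).not_desc (by rwa [rightVertex_inr])
  rwa [rightVertex_inr] at this

/-! ### The tour passes all ends -/

theorem exists_iterate_pair {c : Color} {M : W ⊕ B → Prop} {p q : W ⊕ B}
    (hstep : ∀ d, d ≠ p → d ≠ q → (M (s.tour c d) ↔ M d)) (hp : ¬ M p) (hp' : M (s.tour c p))
    {d : W ⊕ B} (hd : d = p ∨ d = q) (h : ∃ k, (s.tour c)^[k] (Sum.inl T.outer) = d) :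
    (∃ k, (s.tour c)^[k] (Sum.inl T.outer) = p) ∧
      ∃ k, (s.tour c)^[k] (Sum.inl T.outer) = q := by
  have := finite_ends T
  have hinj := s.tour_injective c
  obtain ⟨n, hn⟩ := exists_iterate_eq_of_crossing hinj hstep hp hp'
  obtain ⟨m, hm⟩ := exists_iterate_eq_symm hinj hn
  obtain ⟨k, hk⟩ := h
  rcases hd with rfl | rfl
  · exact ⟨⟨k, hk⟩, n + k, by rw [Function.iterate_add_apply, hk, hn]⟩
  · exact ⟨⟨m + k, by rw [Function.iterate_add_apply, hk, hm]⟩, k, hk⟩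

/-- Descent from the vertex matched to the arrow (for the outer triangle, from its root of colour
`c.next`) changes only at the two ends of this arrow, so an orbit through one end passes the other.
-/
theorem exists_iterate_tour_both {c : Color} {d : W ⊕ B}
    (h : ∃ k, (s.tour c)^[k] (Sum.inl T.outer) = d) :
    (∃ k, (s.tour c)^[k] (Sum.inl T.outer) = Sum.inl (T.arrowOf c d)) ∧
      ∃ k, (s.tour c)^[k] (Sum.inl T.outer) = Sum.inr (T.edge c (T.arrowOf c d)) := by
  obtain ⟨k, hk⟩ := h
  have hr := s.rooted_iterate_tour c k
  have hr' := s.rooted_iterate_tour c (k + 1)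
  rw [Function.iterate_succ_apply', hk] at hr'
  rw [hk] at hr
  have hd := T.eq_or_eq_opp c d
  set a := T.arrowOf c d
  rcases cases_color (s := s) c a with ha | ha | ha | ha
  · have hA : a ∉ s.arrows c := ha ▸ s.outer_notMem c
    refine exists_iterate_pair (M := fun d => s.Desc c (T.vertex c.next a) (T.rightVertex c d))
      ?_ ?_ ?_ hd ⟨k, hk⟩
    · rw [ha]; exact desc_rightVertex_outer_step
    · rw [ha]; exact fun h => Color.next_ne_prev c (T.vertex_color (desc_root h))
    · rw [rightVertex_tour_head hA]; exact desc_self _ _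
  · have hroot : s.Rooted c (T.vertex c a) := by
      rcases hd with h | h
      · rw [h] at hr; exact hr.1
      · rw [h, leftVertex_tour_tail ha] at hr'; exact hr'.1
    refine (exists_iterate_pair (M := fun d => s.Desc c (T.vertex c a) (T.leftVertex c d))
      ?_ ?_ ?_ hd.symm ⟨k, hk⟩).symm
    · exact fun d h1 h2 => desc_leftVertex_step ha d h2 h1
    · exact not_desc_leftVertex_tail ha hroot
    · rw [leftVertex_tour_tail ha]; exact desc_self _ _
  · have hA := notMem_of_mem ha (Color.prev_ne c)
    have hroot : s.Rooted c (T.vertex c.prev a) := by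
      rcases hd with h | h
      · rw [h] at hr; exact hr.2
      · rw [h, rightVertex_tour_tail hA] at hr'; exact hr'.2
    refine (exists_iterate_pair (M := fun d => s.Desc c (T.vertex c.prev a) (T.rightVertex c d))
      ?_ ?_ ?_ hd.symm ⟨k, hk⟩).symm
    · exact fun d h1 h2 => desc_rightVertex_step ha d h2 h1
    · rw [rightVertex_inr]; exact not_desc_vertex_next ha hroot
    · rw [rightVertex_tour_tail hA]; exact desc_self _ _
  · have hA := notMem_of_mem ha (Color.next_ne c)
    have hroot : s.Rooted c (T.vertex c.next a) := by
      rcases hd with h | h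
      · rw [h, rightVertex_tour_head hA] at hr'; exact hr'.2
      · rw [h, rightVertex_inr] at hr; exact hr.2
    refine exists_iterate_pair (M := fun d => s.Desc c (T.vertex c.next a) (T.rightVertex c d))
      ?_ ?_ ?_ hd ⟨k, hk⟩
    · exact fun d h1 h2 => desc_rightVertex_step ha d h1 h2
    · exact not_desc_vertex_prev ha hroot
    · rw [rightVertex_tour_head hA]; exact desc_self _ _

theorem exists_iterate_tour_ccw {c : Color} {d : W ⊕ B}
    (h : ∃ k, (s.tour c)^[k] (Sum.inl T.outer) = d) :
    ∃ k, (s.tour c)^[k] (Sum.inl T.outer) = T.ccw c d := by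
  by_cases hA : T.arrowOf c d ∈ s.arrows c
  · have h' : ∃ k, (s.tour c)^[k] (Sum.inl T.outer) = T.opp c d := by
      have := exists_iterate_tour_both h
      rcases d with w | b
      · exact this.2
      · exact this.1
    obtain ⟨k, hk⟩ := h'
    refine ⟨k + 1, ?_⟩
    rw [Function.iterate_succ_apply', hk, tour_of_mem (by simpa using hA), T.opp_opp]
  · obtain ⟨k, hk⟩ := h
    exact ⟨k + 1, by rw [Function.iterate_succ_apply', hk, tour_of_notMem hA]⟩

theorem exists_iterate_tour_of_ccw {c : Color} {d : W ⊕ B}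
    (h : ∃ k, (s.tour c)^[k] (Sum.inl T.outer) = T.ccw c d) :
    ∃ k, (s.tour c)^[k] (Sum.inl T.outer) = d := by
  have := finite_ends T
  have key : ∀ n, ∃ k, (s.tour c)^[k] (Sum.inl T.outer) = (T.ccw c)^[n + 1] d := by
    intro n
    induction n with
    | zero => exact h
    | succ n ih => rw [Function.iterate_succ_apply']; exact exists_iterate_tour_ccw ih
  -- Turning on counter-clockwise from `T.ccw c d` eventually leads back to `d`.
  obtain ⟨N, hN, hper⟩ := exists_pos_iterate_eq_self (T.ccw_injective c) d
  have := key (N - 1)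
  rwa [Nat.sub_add_cancel hN, hper] at this

variable (s) in
/-- The tour passes all ends of arrows. -/
theorem exists_iterate_tour (c : Color) (d : W ⊕ B) :
    ∃ k, (s.tour c)^[k] (Sum.inl T.outer) = d := by
  have adj : ∀ c' w, (∃ k, (s.tour c)^[k] (Sum.inl T.outer) = Sum.inl w) ↔
      ∃ k, (s.tour c)^[k] (Sum.inl T.outer) = Sum.inr (T.edge c' w) := by
    intro c' w
    rcases Color.eq_or c c' with rfl | rfl | rfl
    · constructor
      · exact fun h => (exists_iterate_tour_both h).2
      · intro h
        simpa [Trinity.arrowOf] using (exists_iterate_tour_both h).1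
    · have : T.ccw c (Sum.inr (T.edge c.next w)) = Sum.inl w := by simp [Trinity.ccw]
      rw [← this]
      exact ⟨exists_iterate_tour_of_ccw, exists_iterate_tour_ccw⟩
    · exact ⟨exists_iterate_tour_ccw (d := Sum.inl w), exists_iterate_tour_of_ccw (d := Sum.inl w)⟩
  have key := T.connected (Sum.inl T.outer) d
  have gen : ∀ t t' : W ⊕ B,
      Relation.EqvGen (fun x y => ∃ c w, x = Sum.inl w ∧ y = Sum.inr (T.edge c w)) t t' →
      ((∃ k, (s.tour c)^[k] (Sum.inl T.outer) = t) ↔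
        ∃ k, (s.tour c)^[k] (Sum.inl T.outer) = t') := by
    intro t t' h
    induction h with
    | rel x y h =>
      obtain ⟨c', w, rfl, rfl⟩ := h
      exact adj c' w
    | refl x => exact Iff.rfl
    | symm x y _ ih => exact ih.symm
    | trans x y z _ _ ih1 ih2 => exact ih1.trans ih2
  exact (gen _ _ key).1 ⟨0, rfl⟩

-- Since the tour is exhaustive, acyclicity now holds everywhere.
variable (s) in
theorem rooted_leftVertex (c : Color) (d : W ⊕ B) : s.Rooted c (T.leftVertex c d) := by
  obtain ⟨k, rfl⟩ := s.exists_iterate_tour c d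
  exact (s.rooted_iterate_tour c k).1

variable (s) in
theorem rooted_rightVertex (c : Color) (d : W ⊕ B) : s.Rooted c (T.rightVertex c d) := by
  obtain ⟨k, rfl⟩ := s.exists_iterate_tour c d
  exact (s.rooted_iterate_tour c k).2

/-! ### The order in which the tour passes the ends -/

variable (s) in
/-- The time at which the tour passes an end. -/
noncomputable def time (c : Color) (d : W ⊕ B) : ℕ := visitTime (s.exists_iterate_tour c) d

variable (s) in
theorem time_injective (c : Color) : Function.Injective (s.time c) :=
  visitTime_injective (s.exists_iterate_tour c)

variable (s) in
theorem time_outer (c : Color) : s.time c (Sum.inl T.outer) = 0 :=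
  visitTime_start (s.exists_iterate_tour c)

/-- The descendants of the head of an arrow of the constituent are visited between the passages of
the tail and of the head of the arrow. -/
theorem desc_leftVertex_iff_time {c : Color} {a : W} (ha : a ∈ s.arrows c) (d : W ⊕ B) :
    s.Desc c (T.vertex c a) (T.leftVertex c d) ↔
      s.time c (Sum.inr (T.edge c a)) < s.time c d ∧ s.time c d ≤ s.time c (Sum.inl a) := by
  refine crossing_iff_visitTime (s.exists_iterate_tour c)
    (M := fun d => s.Desc c (T.vertex c a) (T.leftVertex c d)) ?_ ?_ ?_ ?_ ?_ d
  · exact fun d h1 h2 => desc_leftVertex_step ha d h2 h1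
  · exact fun h => s.vertex_ne_root ha _ (desc_root h)
  · rw [leftVertex_tour_tail ha]; exact desc_self _ _
  · exact desc_self _ _
  · rw [leftVertex_tour_head ha]
    exact not_desc_leftVertex_tail ha (s.rooted_leftVertex c (Sum.inl a))

theorem desc_rightVertex_iff_time {c : Color} {a : W} (ha : a ∈ s.arrows c.prev) (d : W ⊕ B) :
    s.Desc c (T.vertex c.prev a) (T.rightVertex c d) ↔
      s.time c (Sum.inr (T.edge c a)) < s.time c d ∧ s.time c d ≤ s.time c (Sum.inl a) := by
  have hA := notMem_of_mem ha (Color.prev_ne c)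
  refine crossing_iff_visitTime (s.exists_iterate_tour c)
    (M := fun d => s.Desc c (T.vertex c.prev a) (T.rightVertex c d)) ?_ ?_ ?_ ?_ ?_ d
  · exact fun d h1 h2 => desc_rightVertex_step ha d h2 h1
  · exact fun h => s.vertex_ne_root ha _ (desc_root h)
  · rw [rightVertex_tour_tail hA]; exact desc_self _ _
  · exact desc_self _ _
  · rw [rightVertex_tour_head hA]
    exact not_desc_vertex_next ha (s.rooted_rightVertex c (Sum.inl a))

theorem time_tail_lt_head_of_mem {c : Color} {a : W} (ha : a ∈ s.arrows c) :
    s.time c (Sum.inr (T.edge c a)) < s.time c (Sum.inl a) :=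
  ((desc_leftVertex_iff_time ha (Sum.inl a)).1 (desc_self _ _)).1

theorem time_tail_lt_head {c : Color} {a : W} (ha : a ∈ s.arrows c.prev) :
    s.time c (Sum.inr (T.edge c a)) < s.time c (Sum.inl a) :=
  ((desc_rightVertex_iff_time ha (Sum.inl a)).1 (desc_self _ _)).1

theorem time_head_lt_tail {c : Color} {a : W} (ha : a ∈ s.arrows c.next) :
    s.time c (Sum.inl a) < s.time c (Sum.inr (T.edge c a)) := by
  refine visitTime_crossing_lt (s.exists_iterate_tour c)
    (M := fun d => s.Desc c (T.vertex c.next a) (T.rightVertex c d)) ?_ ?_ ?_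
  · exact fun d h1 h2 => desc_rightVertex_step ha d h1 h2
  · exact fun h => s.vertex_ne_root ha _ (desc_root h)
  · rw [rightVertex_inr]; exact desc_self _ _

/-- Arrows outside the constituent do not cross. -/
theorem time_head_mem_iff_tail {c : Color} {e a : W} (he : e ∈ s.arrows c.prev)
    (ha : a ∉ s.arrows c) (hne : a ≠ e) :
    (s.time c (Sum.inr (T.edge c e)) < s.time c (Sum.inl a) ∧
        s.time c (Sum.inl a) ≤ s.time c (Sum.inl e)) ↔
      s.time c (Sum.inr (T.edge c e)) < s.time c (Sum.inr (T.edge c a)) ∧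
        s.time c (Sum.inr (T.edge c a)) ≤ s.time c (Sum.inl e) := by
  rw [← desc_rightVertex_iff_time he, ← desc_rightVertex_iff_time he]
  exact desc_rightVertex_iff ha (fun _ c' => s.vertex_ne_root he c')
    fun c' h hv => hne (s.arrow_unique h he hv)

/-! ### Comparison with the greedy search -/

variable (s) in
/-- The arrow `e` is not in the constituent of colour `c`, but its tail is passed by the tour before
its head is reached along the arrow `f` of the constituent. -/
structure Deviates (c : Color) (e f : W) : Prop where
  notMem : e ∉ s.arrows c
  mem : f ∈ s.arrows c
  vertex_eq : T.vertex c e = T.vertex c f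
  time_lt : s.time c (Sum.inr (T.edge c e)) < s.time c (Sum.inr (T.edge c f))

/-- Invariant: the search is where the tour is, and has selected the constituent arrows whose tails
the tour has passed. -/
theorem greedyStep_iterate {c : Color} (h : ∀ e f, ¬ s.Deviates c e f) (k : ℕ) :
    (T.greedyStep c)^[k] (Sum.inl T.outer, ∅) = ((s.tour c)^[k] (Sum.inl T.outer),
      {a ∈ s.arrows c | ∃ i < k, (s.tour c)^[i] (Sum.inl T.outer) = Sum.inr (T.edge c a)}) := by
  induction k with
  | zero => simp
  | succ k ih =>
    rw [Function.iterate_succ_apply', Function.iterate_succ_apply', ih]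
    set d := (s.tour c)^[k] (Sum.inl T.outer) with hd
    have visited : ∀ {d'}, s.time c d' < s.time c d →
        ∃ i < k, (s.tour c)^[i] (Sum.inl T.outer) = d' := fun {d'} hlt =>
      ⟨_, lt_of_lt_of_le hlt (visitTime_le (s.exists_iterate_tour c) hd.symm),
        iterate_visitTime (s.exists_iterate_tour c) d'⟩
    set S := {a ∈ s.arrows c | ∃ i < k, (s.tour c)^[i] (Sum.inl T.outer) = Sum.inr (T.edge c a)}
      with hS
    have hset : S ∪ T.selected c d S = {a ∈ s.arrows c | ∃ i < k + 1,
        (s.tour c)^[i] (Sum.inl T.outer) = Sum.inr (T.edge c a)} := by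
      ext a
      constructor
      · rintro (⟨ha, i, hi, hx⟩ | ⟨hda, hroot, hnew⟩)
        · exact ⟨ha, i, by omega, hx⟩
        · refine ⟨?_, k, by omega, hda⟩
          by_contra hA
          obtain ⟨f, hf, hv⟩ := s.exists_arrow hroot
          -- Were `a` outside the constituent, then without deviation the tail of `f` would have
          -- come first, so the search would already have reached this head.
          have hle := not_lt.1 fun hlt => h a f ⟨hA, hf, hv.symm, hlt⟩
          have hne : s.time c (Sum.inr (T.edge c f)) ≠ s.time c (Sum.inr (T.edge c a)) := by
            intro heq
            have := s.time_injective c heq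
            simp only [Sum.inr.injEq, EmbeddingLike.apply_eq_iff_eq] at this
            exact hA (this ▸ hf)
          exact hnew f ⟨hf, visited (hda ▸ lt_of_le_of_ne hle hne)⟩ hv.symm
      · rintro ⟨ha, i, hi, hx⟩
        by_cases hin : a ∈ S
        · exact Or.inl hin
        · refine Or.inr ⟨?_, s.vertex_ne_root ha c, fun u hu hv => ?_⟩
          · rcases Nat.lt_succ_iff_lt_or_eq.1 hi with hlt | rfl
            · exact absurd ⟨ha, i, hlt, hx⟩ hin
            · exact hx
          · exact hin (s.arrow_unique ha hu.1 hv ▸ hu)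
    have hmem : T.arrowOf c d ∈ S ∪ T.selected c d S ↔ T.arrowOf c d ∈ s.arrows c := by
      rw [hset]
      refine ⟨fun h => h.1, fun hA => ⟨hA, ?_⟩⟩
      rcases T.eq_or_eq_opp c d with heq | heq
      -- At the head of a constituent arrow the tail has been passed before, so the search
      -- backtracks as the tour does.
      · have hlt := time_tail_lt_head_of_mem hA
        rw [← heq] at hlt
        obtain ⟨i, hi, hx⟩ := visited hlt
        exact ⟨i, by omega, hx⟩
      · exact ⟨k, by omega, heq⟩
    refine Prod.ext ?_ hset
    simp only [greedyStep, tour]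
    by_cases hA : T.arrowOf c d ∈ s.arrows c
    · rw [if_pos hA, if_pos (hmem.2 hA)]
    · rw [if_neg hA, if_neg (mt hmem.1 hA)]

/-- If the tour around the constituent never deviates from the greedy search, then the constituent
is the clocked arborescence. -/
theorem arrows_eq_clocked {c : Color} (h : ∀ e f, ¬ s.Deviates c e f) :
    s.arrows c = T.clocked c := by
  ext w
  simp only [clocked, Set.mem_ofPred_eq, greedyStep_iterate h]
  constructor
  · intro hw
    obtain ⟨k, hk⟩ := s.exists_iterate_tour c (Sum.inr (T.edge c w))
    exact ⟨k + 1, hw, k, by omega, hk⟩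
  · rintro ⟨k, hw, -⟩
    exact hw

/-! ### The region cut off by a deviating arrow -/

namespace Deviates

variable {c : Color} {e f : W}

theorem ne_outer (h : s.Deviates c e f) : e ≠ T.outer := by
  rintro rfl
  exact s.vertex_ne_root h.mem c h.vertex_eq.symm

theorem ne (h : s.Deviates c e f) : e ≠ f := fun hef => h.notMem (hef ▸ h.mem)

theorem time_head (h : s.Deviates c e f) :
    s.time c (Sum.inr (T.edge c f)) < s.time c (Sum.inl e) ∧
      s.time c (Sum.inl e) < s.time c (Sum.inl f) := by
  have h1 := (desc_leftVertex_iff_time h.mem (Sum.inl e)).1 (by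
    rw [← h.vertex_eq]; exact desc_self _ _)
  refine ⟨h1.1, lt_of_le_of_ne h1.2 fun heq => h.ne ?_⟩
  simpa using s.time_injective c heq

/-- The tail of `e` precedes its head, which excludes a matching to colour `c.next`. -/
theorem mem_prev (h : s.Deviates c e f) : e ∈ s.arrows c.prev := by
  rcases cases_color (s := s) c e with he | he | he | he
  · exact absurd he h.ne_outer
  · exact absurd he h.notMem
  · exact he
  · have h1 := time_head_lt_tail he
    have h2 := h.time_lt
    have h3 := h.time_head.1
    omega

end Deviates

variable (s) in
/-- The ends that the tour passes after it has moved along the arrow `f` and not later than the head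
of the arrow `e`. -/
def Between (c : Color) (e f : W) (d : W ⊕ B) : Prop :=
  s.time c (Sum.inr (T.edge c f)) < s.time c d ∧ s.time c d ≤ s.time c (Sum.inl e)

namespace Deviates

variable {c : Color} {e f : W}

theorem between_head (h : s.Deviates c e f) : s.Between c e f (Sum.inl e) :=
  ⟨h.time_head.1, le_rfl⟩

theorem not_between_tail (h : s.Deviates c e f) :
    ¬ s.Between c e f (Sum.inr (T.edge c e)) := fun hb => by
  have h1 := hb.1
  have h2 := h.time_lt
  omega

theorem not_between_head_mem (h : s.Deviates c e f) : ¬ s.Between c e f (Sum.inl f) := fun hb => by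
  have h1 := hb.2
  have h2 := h.time_head.2
  omega

theorem not_between_tail_mem (_h : s.Deviates c e f) :
    ¬ s.Between c e f (Sum.inr (T.edge c f)) := fun hb => lt_irrefl _ hb.1

theorem between_tour_tail_mem (h : s.Deviates c e f) :
    s.Between c e f (s.tour c (Sum.inr (T.edge c f))) := by
  have h1 := h.time_head.1
  have h2 : s.time c (s.tour c (Sum.inr (T.edge c f))) = _ :=
    visitTime_apply (s.exists_iterate_tour c) h1
  change _ = s.time c (Sum.inr (T.edge c f)) + 1 at h2
  constructor <;> omega

theorem not_between_tour_head (h : s.Deviates c e f) :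
    ¬ s.Between c e f (s.tour c (Sum.inl e)) := fun hb => by
  have h1 : s.time c (s.tour c (Sum.inl e)) = _ :=
    visitTime_apply (s.exists_iterate_tour c) (lt_of_lt_of_le h.time_head.2 le_rfl)
  change _ = s.time c (Sum.inl e) + 1 at h1
  have := hb.2
  omega

theorem between_tour_iff (h : s.Deviates c e f) {d : W ⊕ B} (hd : d ≠ Sum.inl e)
    (hd' : d ≠ Sum.inr (T.edge c f)) : s.Between c e f (s.tour c d) ↔ s.Between c e f d := by
  have n1 : s.time c d ≠ s.time c (Sum.inl e) := fun heq => hd (s.time_injective c heq)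
  have n2 : s.time c d ≠ s.time c (Sum.inr (T.edge c f)) :=
    fun heq => hd' (s.time_injective c heq)
  have h0 := h.time_head
  unfold Between
  by_cases hlt : s.time c d < s.time c (Sum.inl f)
  · have h1 : s.time c (s.tour c d) = s.time c d + 1 :=
      visitTime_apply (s.exists_iterate_tour c) hlt
    rw [h1]; omega
  -- Here `d` is past the region; the next time is larger still or wraps around to 0, also outside.
  · have h1 : s.time c (s.tour c d) = 0 ∨ s.time c (s.tour c d) = s.time c d + 1 := by
      by_cases hs : s.tour c d = Sum.inl T.outer
      · left; rw [hs]; exact s.time_outer c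
      · right
        exact visitTime_apply_of_ne (s.exists_iterate_tour c) (s.tour_injective c) hs
    omega

/-- The arrows of the constituent other than `f` do not leave the region. -/
theorem between_head_iff_tail (h : s.Deviates c e f) {a : W} (ha : a ∈ s.arrows c) :
    s.Between c e f (Sum.inl a) ↔ s.Between c e f (Sum.inr (T.edge c a)) := by
  by_cases haf : a = f
  · subst haf
    exact iff_of_false h.not_between_head_mem h.not_between_tail_mem
  have hv : T.vertex c f ≠ T.vertex c a := fun hv => haf (s.arrow_unique h.mem ha hv).symm
  have key := desc_leftVertex_iff h.mem hv
  -- The interval of descendants of the head of `a` contains both the head of `e` and the tail of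
  -- `f`, or neither. So the passages of `a` lie both inside or both outside the region.
  have key' : s.Desc c (T.vertex c a) (T.leftVertex c (Sum.inl e)) ↔
      s.Desc c (T.vertex c a) (T.leftVertex c (Sum.inr (T.edge c f))) := by
    rw [← key]
    simp only [Trinity.leftVertex, h.vertex_eq]
  rw [desc_leftVertex_iff_time ha, desc_leftVertex_iff_time ha] at key'
  have hlt := time_tail_lt_head_of_mem ha
  have n1 : s.time c (Sum.inr (T.edge c a)) ≠ s.time c (Sum.inr (T.edge c f)) := fun heq => by
    have := s.time_injective c heq
    simp only [Sum.inr.injEq, EmbeddingLike.apply_eq_iff_eq] at this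
    exact haf this
  have n2 : s.time c (Sum.inl a) ≠ s.time c (Sum.inl e) := fun heq => by
    have := s.time_injective c heq
    simp only [Sum.inl.injEq] at this
    exact h.notMem (this ▸ ha)
  have n3 : s.time c (Sum.inr (T.edge c a)) ≠ s.time c (Sum.inl e) := fun heq => by
    simpa using s.time_injective c heq
  have n4 : s.time c (Sum.inl a) ≠ s.time c (Sum.inr (T.edge c f)) := fun heq => by
    simpa using s.time_injective c heq
  have h0 := h.time_head
  unfold Between
  omega

theorem between_ccw_iff (h : s.Deviates c e f) {d : W ⊕ B} (hd : d ≠ Sum.inl e)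
    (hd' : d ≠ Sum.inl f) : s.Between c e f (T.ccw c d) ↔ s.Between c e f d := by
  by_cases hA : T.arrowOf c d ∈ s.arrows c
  · have h1 : T.ccw c d = s.tour c (T.opp c d) := by
      rw [tour_of_mem (by simpa using hA), T.opp_opp]
    have h2 : s.Between c e f (T.opp c d) ↔ s.Between c e f d := by
      have := h.between_head_iff_tail hA
      rcases d with w | b
      · exact this.symm
      · simpa [Trinity.opp, Trinity.arrowOf] using this
    rw [h1, h.between_tour_iff, h2]
    · intro h3
      have : T.arrowOf c d = e := by rw [← T.arrowOf_opp, h3]; rfl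
      exact h.notMem (this ▸ hA)
    · intro h3
      apply hd'
      rw [← T.opp_opp c d, h3]
      simp [Trinity.opp]
  · rw [← tour_of_notMem hA]
    refine h.between_tour_iff hd ?_
    rintro rfl
    exact hA (by simpa [Trinity.arrowOf] using h.mem)

theorem between_ccw_mem (h : s.Deviates c e f) : s.Between c e f (T.ccw c (Sum.inl f)) := by
  have := h.between_tour_tail_mem
  rwa [tour_of_mem (by simpa [Trinity.arrowOf] using h.mem), show
    T.opp c (Sum.inr (T.edge c f)) = Sum.inl f by simp [Trinity.opp]] at this

theorem not_between_ccw (h : s.Deviates c e f) : ¬ s.Between c e f (T.ccw c (Sum.inl e)) := by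
  have := h.not_between_tour_head
  rwa [tour_of_notMem (by simpa [Trinity.arrowOf] using h.notMem)] at this

/-- An arrow that leads into the region is itself deviating and cuts off a smaller region. -/
theorem exists_shorter (h : s.Deviates c e f) {a : W} (ha : a ∉ s.arrows c) (hne : a ≠ e)
    (h1 : s.Between c e f (Sum.inl a)) (h2 : ¬ s.Between c e f (Sum.inr (T.edge c a))) :
    ∃ g, s.Deviates c a g ∧ s.time c (Sum.inl a) < s.time c (Sum.inl e) ∧
      s.time c (Sum.inr (T.edge c f)) ≤ s.time c (Sum.inr (T.edge c g)) := by
  have hlt := h.time_lt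
  have h0 := h.time_head
  -- The tail of `a` lies between the passages of `e`; being outside the region, it must precede the
  -- tail of `f`.
  have nc := (time_head_mem_iff_tail h.mem_prev ha hne).1 ⟨by have := h1.1; omega, h1.2⟩
  have hdesc : s.Desc c (T.vertex c f) (T.vertex c a) :=
    (desc_leftVertex_iff_time h.mem (Sum.inl a)).2 ⟨h1.1, by have := h1.2; omega⟩
  have hroot : T.vertex c a ≠ T.vertex c T.outer := fun hr => by
    rw [hr] at hdesc
    exact s.vertex_ne_root h.mem _ (desc_root hdesc)
  obtain ⟨g, hg, hv⟩ := s.exists_arrow hroot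
  have hle : s.time c (Sum.inr (T.edge c f)) ≤ s.time c (Sum.inr (T.edge c g)) := by
    by_cases hgf : g = f
    · rw [hgf]
    · have hv' : T.vertex c g ≠ T.vertex c f := fun hv' => hgf (s.arrow_unique hg h.mem hv')
      have := (desc_leftVertex_iff hg hv').1 (by
        change s.Desc c (T.vertex c f) (T.vertex c g)
        rwa [hv])
      exact ((desc_leftVertex_iff_time h.mem _).1 this).1.le
  have n1 : s.time c (Sum.inl a) ≠ s.time c (Sum.inl e) := fun heq => by
    have := s.time_injective c heq
    simp only [Sum.inl.injEq] at this
    exact hne this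
  have n2 : s.time c (Sum.inr (T.edge c a)) ≠ s.time c (Sum.inr (T.edge c f)) := fun heq => by
    have := s.time_injective c heq
    simp only [Sum.inr.injEq, EmbeddingLike.apply_eq_iff_eq] at this
    exact ha (this ▸ h.mem)
  refine ⟨g, ⟨ha, hg, hv.symm, ?_⟩, ?_, hle⟩
  · unfold Between at h2
    omega
  · have := h1.2
    omega

end Deviates

/-- If the constituent is not clocked, there is a deviating arrow such that no arrow leads into the
region it cuts off. -/
theorem exists_deviates_minimal {c : Color} (hc : s.arrows c ≠ T.clocked c) :
    ∃ e f, s.Deviates c e f ∧ ∀ a, a ∉ s.arrows c → a ≠ e → s.Between c e f (Sum.inl a) →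
      s.Between c e f (Sum.inr (T.edge c a)) := by
  classical
  -- Minimize the number of steps from the tail of `f` to the head of `e`.
  have hex : ∃ n e f, s.Deviates c e f ∧
      s.time c (Sum.inl e) - s.time c (Sum.inr (T.edge c f)) = n := by
    by_contra! hno
    exact hc (arrows_eq_clocked fun e f h => hno _ e f h rfl)
  obtain ⟨e, f, h, hn⟩ := Nat.find_spec hex
  refine ⟨e, f, h, fun a ha hne h1 => ?_⟩
  by_contra h2
  obtain ⟨g, hg, hlt, hle⟩ := h.exists_shorter ha hne h1 h2
  have := Nat.find_min' hex ⟨a, g, hg, rfl⟩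
  have := hg.time_head
  omega

/-! ### Performing a move -/

/-- Rematching along a clockwise triangle yields a state again. -/
theorem exists_rematch (s : T.State) {w : Color → W} (hw : T.IsTriangle w)
    (hs : ∀ c, w c ∈ s.arrows c.next) :
    ∃ t : T.State, (∀ c, w c ∈ t.arrows c.prev) ∧
      ∀ u, (∀ c, u.1 ≠ w c) → t.matching u = s.matching u := by
  classical
  have hne : ∀ c, w c ≠ T.outer := fun c => s.ne_outer (hs c)
  have hinj : Function.Injective w := fun c c' h => by
    have := s.color_unique (hs c) (h ▸ hs c')
    simpa using congrArg Color.prev this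
  let v : Color → {w : W // w ≠ T.outer} := fun c => ⟨w c, hne c⟩
  have hv : Function.Injective v := fun c c' h => hinj (congrArg Subtype.val h)
  let nextPerm : Equiv.Perm Color := ⟨Color.next, Color.prev, by intro c; simp, by intro c; simp⟩
  -- Each `w c` takes over the old partner of `w c.next`, which by `hw` is its own vertex of colour
  -- `c.prev`.
  let σ : Equiv.Perm {w : W // w ≠ T.outer} :=
    nextPerm.extendDomain (Equiv.ofInjective v hv)
  have hσ : ∀ c, σ (v c) = v c.next := fun c => by
    have := Equiv.Perm.extendDomain_apply_image nextPerm (Equiv.ofInjective v hv) c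
    simpa [nextPerm] using this
  have hfix : ∀ u, (∀ c, u.1 ≠ w c) → σ u = u := fun u hu =>
    Equiv.Perm.extendDomain_apply_not_subtype _ _ (by
      rintro ⟨c, rfl⟩
      exact hu c rfl)
  have hm : ∀ c, (s.matching (σ (v c))).1 = T.vertex c.prev (w c) := fun c => by
    obtain ⟨_, h2⟩ := hs c.next
    rw [hσ, h2]
    have := hw c.prev
    rw [Color.prev_next, Color.prev_prev] at this
    rw [Color.next_next]
    exact this.symm
  refine ⟨⟨σ.trans s.matching, fun u => ?_⟩, fun c => ⟨hne c, hm c⟩, fun u hu => ?_⟩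
  · by_cases hu : ∃ c, u.1 = w c
    · obtain ⟨c, hc⟩ := hu
      obtain rfl : u = v c := Subtype.ext hc
      exact ⟨c.prev, hm c⟩
    · push Not at hu
      simp only [Equiv.trans_apply, hfix u hu]
      exact s.incident u
  · simp only [Equiv.trans_apply, hfix u hu]

/-- A state with a constituent that is not clocked admits a clockwise move. -/
theorem exists_clockwiseMove {c : Color} (h : s.arrows c ≠ T.clocked c) :
    ∃ t : T.State, ClockwiseMove s t := by
  have := T.finite_white
  obtain ⟨e, f, hd, hmin⟩ := exists_deviates_minimal h
  let D : Set B := {b | s.Between c e f (Sum.inr b)}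
  have hnext : ∀ u, T.edge c.next u ∈ D ↔ s.Between c e f (Sum.inl u) := fun u => by
    have := hd.between_ccw_iff (d := Sum.inr (T.edge c.next u)) (by simp) (by simp)
    simp only [Trinity.ccw, Equiv.symm_apply_apply] at this
    exact this.symm
  have hprev : ∀ u, u ≠ e → u ≠ f →
      (T.edge c.prev u ∈ D ↔ s.Between c e f (Sum.inl u)) := fun u h1 h2 =>
    hd.between_ccw_iff (d := Sum.inl u) (by simpa using h1) (by simpa using h2)
  have hprevf : T.edge c.prev f ∈ D := hd.between_ccw_mem
  have hpreve : T.edge c.prev e ∉ D := hd.not_between_ccw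
  have hnextf : T.edge c.next f ∉ D := fun h => hd.not_between_head_mem ((hnext f).1 h)
  have hnexte : T.edge c.next e ∈ D := (hnext e).2 hd.between_head
  have hce : T.edge c e ∉ D := hd.not_between_tail
  have hcf : T.edge c f ∉ D := hd.not_between_tail_mem
  -- only the head of `e` makes an arrow into the region
  have hsub : ∀ u, u ≠ e → T.edge c.next u ∈ D → T.edge c u ∈ D := fun u hu h1 => by
    rw [hnext] at h1
    by_cases hA : u ∈ s.arrows c
    · exact (hd.between_head_iff_tail hA).1 h1
    · exact hmin u hA hu h1
  -- a unique arrow leads out of the region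
  obtain ⟨a, ha⟩ : ∃ a, {u | T.edge c u ∈ D} \ ({u | T.edge c.next u ∈ D} \ {e}) = {a} := by
    rw [← Set.ncard_eq_one, Set.ncard_sdiff, Set.ncard_sdiff_singleton_of_mem]
    -- Every `T.edge c'` is a bijection, so the sets of tails and of heads in the region both have
    -- the size of `D`; removing `e` from the heads leaves one tail over.
    · have h1 : ∀ c', {u | T.edge c' u ∈ D}.ncard = D.ncard := fun c' => by
        rw [← Set.ncard_image_of_injective _ (T.edge c').injective]
        congr 1
        ext b
        constructor
        · rintro ⟨u, hu, rfl⟩; exact hu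
        · exact fun hb => ⟨(T.edge c').symm b, by simpa using hb, by simp⟩
      have h2 : 0 < {u | T.edge c.next u ∈ D}.ncard :=
        (Set.ncard_pos).2 ⟨e, hnexte⟩
      rw [h1] at h2 ⊢
      rw [h1]
      omega
    · exact hnexte
    · exact fun u hu => hsub u hu.2 hu.1
  have ha0 : a ∈ {u | T.edge c u ∈ D} \ ({u | T.edge c.next u ∈ D} \ {e}) := by
    rw [ha]; exact Set.mem_singleton a
  have ha1 : T.edge c a ∈ D := ha0.1
  have hae : a ≠ e := fun h => hce (h ▸ ha1)
  have haf : a ≠ f := fun h => hcf (h ▸ ha1)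
  have ha2 : T.edge c.next a ∉ D := fun h => ha0.2 ⟨h, hae⟩
  have ha3 : T.edge c.prev a ∉ D := by
    rw [hprev a hae haf, ← hnext]; exact ha2
  have hauniq : ∀ u, T.edge c u ∈ D → u ≠ a → u ≠ e ∧ T.edge c.next u ∈ D := fun u hu hua => by
    by_contra hcon
    have : u ∈ ({a} : Set W) := ha ▸ ⟨hu, fun h => hcon ⟨h.2, h.1⟩⟩
    exact hua this
  have haA : a ∉ s.arrows c := fun hA => ha2 ((hnext a).2 ((hd.between_head_iff_tail hA).2 ha1))
  have hcross : s.time c (Sum.inr (T.edge c e)) < s.time c (Sum.inl a) ∧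
      s.time c (Sum.inl a) ≤ s.time c (Sum.inl e) :=
    (time_head_mem_iff_tail hd.mem_prev haA hae).2 ⟨hd.time_lt.trans ha1.1, ha1.2⟩
  -- The outer head has time 0, and a matching to colour `c.prev` would put the head after the tail,
  -- hence inside the region.
  have hanext : a ∈ s.arrows c.next := by
    rcases cases_color (s := s) c a with h1 | h1 | h1 | h1
    · rw [h1, s.time_outer] at hcross
      exact absurd hcross.1 (Nat.not_lt_zero _)
    · exact absurd h1 haA
    · exact absurd ((hnext a).2 ⟨ha1.1.trans (time_tail_lt_head h1), hcross.2⟩) ha2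
    · exact h1
  obtain ⟨w, hwc, hwn, hwp⟩ := Color.exists_fun c a e f
  have htri : T.IsTriangle w := by
    refine (Color.forall_iff c).2 ⟨?_, ?_, ?_⟩
    · rw [hwn, hwp]; exact hd.vertex_eq
    · rw [Color.next_next, Color.next_prev, hwp, hwc]
      -- Turning about this vertex leaves `D` at `f`, so it must enter `D` somewhere, and only `a`
      -- allows that.
      obtain ⟨u, hu, h1, h2⟩ := T.exists_vertex_eq_of_crossing (c := c.next) (D := Dᶜ) (w := f)
        (by simpa using hcf) (by simpa using hprevf)
      simp only [Color.next_next, Color.next_prev, Set.mem_compl_iff, not_not] at h1 h2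
      by_cases hua : u = a
      · rw [← hua]; exact hu.symm
      · obtain ⟨h3, h4⟩ := hauniq u h2 hua
        by_cases huf : u = f
        · exact absurd (huf ▸ h2) hcf
        · exact absurd ((hprev u h3 huf).2 ((hnext u).1 h4)) h1
    · rw [Color.prev_next, Color.prev_prev, hwc, hwn]
      -- Here `D` is entered at `e`, and again only `a` allows leaving it.
      obtain ⟨u, hu, h1, h2⟩ := T.exists_vertex_eq_of_crossing (c := c.prev) (D := D) (w := e)
        (by simpa using hnexte) (by simpa using hce)
      simp only [Color.prev_next, Color.prev_prev] at h1 h2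
      by_cases hua : u = a
      · rw [← hua]; exact hu
      · exact absurd (hauniq u h1 hua).2 h2
  have hs : ∀ c', w c' ∈ s.arrows c'.next := by
    refine (Color.forall_iff c).2 ⟨?_, ?_, ?_⟩
    · rw [hwc]; exact hanext
    · rw [hwn, Color.next_next]; exact hd.mem_prev
    · rw [hwp, Color.prev_next]; exact hd.mem
  obtain ⟨t, ht, ht'⟩ := s.exists_rematch htri hs
  -- The disk consists of `D` and the white triangles with all three neighbours in `D`; this leaves
  -- out `a`, `e` and `f`.
  refine ⟨t, w, htri, ⟨{d | Sum.elim (fun u => ∀ c', T.edge c' u ∈ D) (· ∈ D) d}, ?_, ?_⟩,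
    fun c' => ⟨hs c', ht c'⟩, ht'⟩
  · refine (Color.forall_iff c).2 ⟨?_, ?_, ?_⟩
    · rw [hwc]; exact ⟨ha1, fun h => ha2 (h _)⟩
    · rw [hwn]; exact ⟨hnexte, fun h => hce (h _)⟩
    · rw [hwp]; exact ⟨hprevf, fun h => hcf (h _)⟩
  · have hall : ∀ u, u ≠ e → T.edge c.next u ∈ D → ∀ c', T.edge c' u ∈ D := fun u h1 h2 => by
      have huf : u ≠ f := fun h => hnextf (h ▸ h2)
      exact (Color.forall_iff c).2 ⟨hsub u h1 h2, h2, (hprev u h1 huf).2 ((hnext u).1 h2)⟩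
    refine (Color.forall_iff c).2 ⟨fun u hu => ⟨fun h => h _, fun h => ?_⟩,
      fun u hu => ⟨fun h => h _, fun h => ?_⟩, fun u hu => ⟨fun h => h _, fun h => ?_⟩⟩
    · rw [hwc] at hu
      obtain ⟨h1, h2⟩ := hauniq u h hu
      exact hall u h1 h2
    · rw [hwn] at hu
      exact hall u hu h
    · rw [hwp] at hu
      have hue : u ≠ e := fun h' => hpreve (h' ▸ h)
      exact hall u hue ((hnext u).2 ((hprev u hue hu).1 h))

end State

end PlanarTrinity

theorem proposition4p7 {W B : Type*} (T : PlanarTrinity W B) (s : T.State) (c : Color)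
    (h : s.arrows c ≠ T.clocked c) : ∃ t : T.State, PlanarTrinity.ClockwiseMove s t :=
  PlanarTrinity.State.exists_clockwiseMove h
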